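/- Let $X$ be a complex Banach space and let $L(X)$ be the algebra of bounded linear operators on $X$. For $T\in L(X)$ let $T^*\in L(X^*)$ denote its adjoint on the dual space, $T^*\varphi=\varphi\circ T$. An operator is *Weyl* if it is Fredholm (closed range, finite-dimensional kernel, range of finite codimension) of index $\dim\mathcal N(T)-\operatorname{codim}\mathcal R(T)=0$, and *quasi-nilpotent* if its spectral radius is $0$. The operator $T\in L(X)$ is *pseudo B-Weyl* if there are closed $T$-invariant subspaces $X_1,X_2$ of $X$ with $X=X_1\oplus X_2$ such that $T|X_1$ is Weyl and $T|X_2$ is quasi-nilpotent (zero subspaces are allowed), and *generalized Drazin invertible* if $0$ is not an accumulation point of the spectrum $\sigma(T)$. Put $$\sigma_{pBW}(T)=\{\lambda\in\mathbb C: T-\lambda I\text{ is not pseudo B-Weyl}\},$$ $$\sigma_{gD}(T)=\{\lambda\in\mathbb C: T-\lambda I\text{ is not generalized Drazin invertible}\}.$$ The operator $T$ has the *single-valued extension property (SVEP) at* $\lambda\in\mathbb C$ if, for every connected open neighbourhood $U$ of $\lambda$, the only analytic function $f:U\to X$ with $(T-\mu I)f(\mu)=0$ for all $\mu\in U$ is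 $f\equiv 0$; let $\mathcal S(T)$ be the set of $\lambda\in\mathbb C$ at which $T$ fails to have SVEP. **Theorem.** For every complex Banach space $X$ and every $T\in L(X)$, $$\sigma_{pBW}(T)\cup[\mathcal S(T)\cap\mathcal S(T^*)]=\sigma_{gD}(T).$$ -/

import Mathlib

open Topology

noncomputable section

variable {X : Type*} [NormedAddCommGroup X] [NormedSpace ℂ X]

/-- The adjoint `T* : X* → X*`, `φ ↦ φ ∘ T`, on the topological dual of `X`. -/
def banachAdjoint (T : X →L[ℂ] X) : StrongDual ℂ X →L[ℂ] StrongDual ℂ X :=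
  ContinuousLinearMap.precomp ℂ T

/-- `T` has the single-valued extension property at `z`: on every connected open neighbourhood `U`
of `z`, the only analytic solution `f : U → X` of `(T - μ) f(μ) = 0` is `f = 0`. -/
def HasSVEPAt (T : X →L[ℂ] X) (z : ℂ) : Prop :=
  ∀ U : Set ℂ, IsOpen U → IsPreconnected U → z ∈ U →
    ∀ f : ℂ → X, AnalyticOnNhd ℂ f U →
      (∀ μ ∈ U, (T - μ • ContinuousLinearMap.id ℂ X) (f μ) = 0) → ∀ μ ∈ U, f μ = 0

/-- `S(T)`: the set of points at which `T` fails to have the single-valued extension property. -/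
def svepFailureSet (T : X →L[ℂ] X) : Set ℂ :=
  {z | ¬ HasSVEPAt T z}

/-- A Weyl operator: Fredholm of index `dim ker T - codim range T` equal to zero. -/
def IsWeylOperator (T : X →L[ℂ] X) : Prop :=
  T.IsFredholm ∧
    (Module.finrank ℂ T.ker : ℤ) - (Module.finrank ℂ (X ⧸ T.range) : ℤ) = 0

/-- A quasi-nilpotent operator: its spectral radius is zero. -/
def IsQuasiNilpotentOperator (T : X →L[ℂ] X) : Prop :=
  spectralRadius ℂ T = 0

/-- `T` is pseudo B-Weyl: `X` is the direct sum of two closed `T`-invariant subspaces `X₁`, `X₂`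
such that `T|X₁` is Weyl and `T|X₂` is quasi-nilpotent. -/
def IsPseudoBWeyl (T : X →L[ℂ] X) : Prop :=
  ∃ (X₁ X₂ : Submodule ℂ X) (h₁ : Set.MapsTo T X₁ X₁) (h₂ : Set.MapsTo T X₂ X₂),
    IsClosed (X₁ : Set X) ∧ IsClosed (X₂ : Set X) ∧ IsCompl X₁ X₂ ∧
      IsWeylOperator (T.restrict h₁) ∧ IsQuasiNilpotentOperator (T.restrict h₂)

/-- The pseudo B-Weyl spectrum. -/
def pseudoBWeylSpectrum (T : X →L[ℂ] X) : Set ℂ :=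
  {z | ¬ IsPseudoBWeyl (T - z • ContinuousLinearMap.id ℂ X)}

/-- `T` is generalized Drazin invertible: `0` is not an accumulation point of the spectrum. -/
def IsGeneralizedDrazinInvertible (T : X →L[ℂ] X) : Prop :=
  (0 : ℂ) ∉ derivedSet (spectrum ℂ T)

/-- The generalized Drazin spectrum. -/
def generalizedDrazinSpectrum (T : X →L[ℂ] X) : Set ℂ :=
  {z | ¬ IsGeneralizedDrazinInvertible (T - z • ContinuousLinearMap.id ℂ X)}

end

/-! After translation the question is about the point 0. If 0 is not an accumulation point of the
spectrum, the Riesz idempotent splits `X` into a part where `T` is invertible, hence Weyl, and a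
part where it is quasi-nilpotent; and `T` has SVEP at 0, because a solution `f` vanishes wherever `T
- μ` is invertible (`IsGeneralizedDrazinInvertible.isPseudoBWeyl`,
`IsGeneralizedDrazinInvertible.hasSVEPAt`).

Conversely, let `T` be pseudo B-Weyl with Weyl part `T₁ = V + JK`, `V` invertible and `JK` factoring
through `ℂⁿ`. Near 0, invertibility of `T₁ - μ` is governed by the analytic function `det (1 + K (V
- μ)⁻¹ J)`. Either it has no zeros in a punctured disc, and then `T₁ - μ` and so `T - μ` are
invertible there; or it vanishes identically, and then analytic right and left null vectors of the
matrix destroy SVEP at 0 for both `T₁` and its adjoint (`isUnit_sub_smul_id_or_not_hasSVEPAt`).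
These failures pass to `T` and `T*` through the inclusion of `X₁` and the projection onto it, so
SVEP of either `T` or `T*` excludes the second case. -/

/-- The ring of analytic functions on a preconnected set is a domain, stated as: a matrix of
analytic functions with vanishing determinant has a nonzero analytic vector in its kernel. -/
theorem exists_analyticOnNhd_mulVec_eq_zero {n : Type*} [Fintype n] [DecidableEq n] {U : Set ℂ}
    (hU : IsPreconnected U) (hne : U.Nonempty) (M : ℂ → Matrix n n ℂ)
    (hM : ∀ i j, AnalyticOnNhd ℂ (fun z => M z i j) U) (hdet : ∀ z ∈ U, (M z).det = 0) :
    ∃ v : ℂ → n → ℂ, AnalyticOnNhd ℂ v U ∧ (∃ z ∈ U, v z ≠ 0) ∧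
      ∀ z ∈ U, Matrix.mulVec (M z) (v z) = 0 := by
  -- Functions restricted to `U`: values outside `U` are forgotten, so the identity theorem makes
  -- this ring a domain.
  let R : Subring (U → ℂ) :=
    { carrier := {g | ∃ f : ℂ → ℂ, AnalyticOnNhd ℂ f U ∧ ∀ z : U, g z = f z}
      mul_mem' := by
        rintro a b ⟨f, hf, hfa⟩ ⟨g, hg, hgb⟩
        exact ⟨f * g, hf.mul hg, fun z => by simp [hfa, hgb]⟩
      one_mem' := ⟨fun _ => 1, analyticOnNhd_const, fun _ => rfl⟩
      add_mem' := by
        rintro a b ⟨f, hf, hfa⟩ ⟨g, hg, hgb⟩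
        exact ⟨f + g, hf.add hg, fun z => by simp [hfa, hgb]⟩
      zero_mem' := ⟨fun _ => 0, analyticOnNhd_const, fun _ => rfl⟩
      neg_mem' := by
        rintro a ⟨f, hf, hfa⟩
        exact ⟨-f, hf.neg, fun z => by simp [hfa]⟩ }
  have hnt : Nontrivial R := by
    obtain ⟨z, hz⟩ := hne
    refine ⟨⟨0, 1, fun h => ?_⟩⟩
    simpa using congrFun (congrArg Subtype.val h) ⟨z, hz⟩
  have hnz : NoZeroDivisors R := by
    refine ⟨?_⟩
    rintro ⟨a, f, hf, hfa⟩ ⟨b, g, hg, hgb⟩ hab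
    have hfg : ∀ z ∈ U, f z * g z = 0 := fun z hz => by
      have := congrFun (congrArg Subtype.val hab) ⟨z, hz⟩
      simpa [hfa, hgb] using this
    rcases hf.eq_zero_or_eq_zero_of_mul_eq_zero hg hfg hU with h | h
    · left; ext z; simp [hfa, h z z.2]
    · right; ext z; simp [hgb, h z z.2]
  have hdom : IsDomain R := NoZeroDivisors.to_isDomain R
  let N : Matrix n n R := fun i j => ⟨fun z => M z i j, _, hM i j, fun _ => rfl⟩
  let ev (z : U) : R →+* ℂ := (Pi.evalRingHom (fun _ : U => ℂ) z).comp R.subtype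
  have hev (z : U) : (ev z).mapMatrix N = M z := rfl
  have hN : N.det = 0 := by
    ext z
    change ev z N.det = 0
    rw [RingHom.map_det, hev, hdet z z.2]
  obtain ⟨v, hv0, hv⟩ := Matrix.exists_mulVec_eq_zero_iff.2 hN
  choose f hf hfv using fun i => (v i).2
  refine ⟨fun z i => f i z, analyticOnNhd_pi_iff.2 hf, ?_, ?_⟩
  · obtain ⟨i, hi⟩ := Function.ne_iff.1 hv0
    obtain ⟨z, hz⟩ := Function.ne_iff.1 (fun h => hi (Subtype.ext h) : ((v i : R) : U → ℂ) ≠ 0)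
    exact ⟨z, z.2, fun h => hz (by simpa [hfv] using congrFun h i)⟩
  · intro z hz
    ext i
    have := congrArg (ev ⟨z, hz⟩) (congrFun hv i)
    simpa [Matrix.mulVec, dotProduct, ev, hfv, N] using this

/-! ### The single-valued extension property: translation, transfer, isolated spectrum -/

section SVEP

variable {X Y : Type*} [NormedAddCommGroup X] [NormedSpace ℂ X]
  [NormedAddCommGroup Y] [NormedSpace ℂ Y]

theorem HasSVEPAt.of_injective_intertwining {T : X →L[ℂ] X} {S : Y →L[ℂ] Y} (ι : Y →L[ℂ] X)
    (hι : Function.Injective ι) (h : ∀ y, ι (S y) = T (ι y)) {z : ℂ} (hT : HasSVEPAt T z) :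
    HasSVEPAt S z := by
  intro U hUo hUc hz f hf hker μ hμ
  refine hι ?_
  rw [map_zero]
  refine hT U hUo hUc hz (fun μ => ι (f μ)) (ι.comp_analyticOnNhd hf) (fun ν hν => ?_) μ hμ
  have := congrArg ι (hker ν hν)
  simpa [h] using this

theorem HasSVEPAt.sub_smul_id {T : X →L[ℂ] X} {z w : ℂ} (hT : HasSVEPAt T (w + z)) :
    HasSVEPAt (T - z • ContinuousLinearMap.id ℂ X) w := by
  intro U hUo hUc hw f hf hker μ hμ
  have key := hT ((fun μ => μ + z) '' U) ((Homeomorph.addRight z).isOpenMap U hUo)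
    (hUc.image _ (by fun_prop)) ⟨w, hw, rfl⟩ (fun μ => f (μ - z)) ?_ ?_ (μ + z) ⟨μ, hμ, rfl⟩
  · simpa using key
  · rintro _ ⟨ν, hν, rfl⟩
    refine AnalyticAt.fun_comp (f := fun μ : ℂ => μ - z) ?_ (by fun_prop)
    simpa using hf ν hν
  · rintro _ ⟨ν, hν, rfl⟩
    have := hker ν hν
    rw [← this, add_sub_cancel_right, add_smul, add_comm, sub_sub]

theorem hasSVEPAt_sub_smul_id_iff {T : X →L[ℂ] X} {z : ℂ} :
    HasSVEPAt (T - z • ContinuousLinearMap.id ℂ X) 0 ↔ HasSVEPAt T z := by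
  refine ⟨fun h => ?_, fun h => HasSVEPAt.sub_smul_id (by simpa using h)⟩
  have h' : HasSVEPAt (T - z • ContinuousLinearMap.id ℂ X) (z + -z) := by simpa using h
  simpa [sub_eq_add_neg] using h'.sub_smul_id

theorem banachAdjoint_apply (T : X →L[ℂ] X) (φ : StrongDual ℂ X) (x : X) :
    banachAdjoint T φ x = φ (T x) := rfl

theorem banachAdjoint_sub_smul_id (T : X →L[ℂ] X) (z : ℂ) :
    banachAdjoint (T - z • ContinuousLinearMap.id ℂ X) =
      banachAdjoint T - z • ContinuousLinearMap.id ℂ (StrongDual ℂ X) := by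
  ext φ x
  simp [banachAdjoint_apply]

/-- Precomposition with a surjection is injective and intertwines the adjoints in the opposite
direction. -/
theorem HasSVEPAt.banachAdjoint_of_surjective_intertwining {T : X →L[ℂ] X} {S : Y →L[ℂ] Y}
    (π : X →L[ℂ] Y) (hπ : Function.Surjective π) (h : ∀ x, π (T x) = S (π x)) {z : ℂ}
    (hT : HasSVEPAt (banachAdjoint T) z) : HasSVEPAt (banachAdjoint S) z := by
  refine hT.of_injective_intertwining (ContinuousLinearMap.precomp ℂ π) (fun φ ψ hφ => ?_) ?_
  · ext y
    obtain ⟨x, rfl⟩ := hπ y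
    exact DFunLike.congr_fun hφ x
  · intro φ
    ext x
    exact congrArg φ (h x).symm

theorem isGeneralizedDrazinInvertible_iff (T : X →L[ℂ] X) :
    IsGeneralizedDrazinInvertible T ↔
      ∀ᶠ μ in 𝓝[≠] (0 : ℂ), IsUnit (T - μ • ContinuousLinearMap.id ℂ X) := by
  rw [IsGeneralizedDrazinInvertible, mem_derivedSet, accPt_iff_frequently_nhdsNE,
    Filter.not_frequently]
  refine Filter.eventually_congr (Filter.Eventually.of_forall fun μ => ?_)
  rw [spectrum.notMem_iff, IsUnit.sub_iff]
  rfl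

theorem IsGeneralizedDrazinInvertible.hasSVEPAt {T : X →L[ℂ] X}
    (hT : IsGeneralizedDrazinInvertible T) : HasSVEPAt T 0 := by
  intro U hUo hUc h0 f hf hker
  refine hf.eqOn_zero_of_preconnected_of_frequently_eq_zero hUc h0 ?_
  refine Filter.Eventually.frequently ?_
  filter_upwards [(isGeneralizedDrazinInvertible_iff T).1 hT,
    nhdsWithin_le_nhds (hUo.mem_nhds h0)] with μ hu hμ
  obtain ⟨u, hu⟩ := hu
  have := hker μ hμ
  rw [← hu] at this
  calc f μ = ((u⁻¹ : (X →L[ℂ] X)ˣ).val * u.val) (f μ) := by simp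
    _ = 0 := by rw [mul_apply_eq_comp, this, map_zero]

end SVEP

/-! ### Weyl operators and the determinant dichotomy -/

section Fredholm

variable {Y : Type*} [NormedAddCommGroup Y] [NormedSpace ℂ Y] [CompleteSpace Y]

/-- A Weyl operator is an invertible operator plus an operator factoring through `ℂⁿ`. -/
theorem IsWeylOperator.exists_isUnit_add_comp {T : Y →L[ℂ] Y} (hT : IsWeylOperator T) :
    ∃ (n : ℕ) (V : Y →L[ℂ] Y) (K : Y →L[ℂ] (Fin n → ℂ)) (J : (Fin n → ℂ) →L[ℂ] Y),
      IsUnit V ∧ T = V + J ∘L K := by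
  obtain ⟨hF, hind⟩ := hT
  have := hF.finite_ker
  have hfq : FiniteDimensional ℂ (Y ⧸ T.range) := hF.finite_coker
  have hdim : Module.finrank ℂ T.ker = Module.finrank ℂ (Y ⧸ T.range) := by omega
  obtain ⟨p, hp⟩ := hF.closedComplemented_ker
  let n := Module.finrank ℂ T.ker
  let e₁ : T.ker ≃ₗ[ℂ] (Fin n → ℂ) := LinearEquiv.ofFinrankEq _ _ (by simp [n])
  let e₂ : (Fin n → ℂ) ≃ₗ[ℂ] (Y ⧸ T.range) := LinearEquiv.ofFinrankEq _ _ (by simp [n, hdim])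
  obtain ⟨s, hs⟩ := T.range.mkQ.exists_rightInverse_of_surjective T.range.range_mkQ
  -- `K` extends an isomorphism of the kernel with `ℂⁿ`, and `J` maps `ℂⁿ` onto a complement of the
  -- range; index zero gives the same `n`. Subtracting `J ∘L K` thus repairs both kernel and
  -- cokernel.
  let K : Y →L[ℂ] (Fin n → ℂ) := e₁.toLinearMap.toContinuousLinearMap ∘L p
  let J : (Fin n → ℂ) →L[ℂ] Y := (s ∘ₗ e₂.toLinearMap).toContinuousLinearMap
  have hK (x : T.ker) : K x = e₁ x := by simp [K, hp]
  have hJ (c : Fin n → ℂ) : T.range.mkQ (J c) = e₂ c := DFunLike.congr_fun hs (e₂ c)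
  have hmk (x : Y) : T.range.mkQ (T x) = 0 :=
    (Submodule.Quotient.mk_eq_zero _).2 ⟨x, rfl⟩
  refine ⟨n, T - J ∘L K, K, J, ContinuousLinearMap.isUnit_iff_bijective.2 ⟨?_, fun y => ?_⟩,
    by simp⟩
  · rw [injective_iff_map_eq_zero]
    intro x hx
    have hx' : T x = J (K x) := by simpa [sub_eq_zero] using hx
    have hKx : K x = 0 := by
      have := hmk x
      rw [hx', hJ] at this
      simpa using this
    have hxk : x ∈ T.ker := by simp [hx', hKx]
    have := hK ⟨x, hxk⟩
    rw [hKx] at this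
    simpa using this.symm
  · let c := e₂.symm (T.range.mkQ y)
    obtain ⟨x, hx⟩ : y - J c ∈ T.range := by
      rw [← Submodule.ker_mkQ T.range, LinearMap.mem_ker, map_sub, hJ]
      simp [c]
    let k := e₁.symm (-c - K x)
    refine ⟨x + k, ?_⟩
    have hk : T k = 0 := k.2
    have hKk : K k = -c - K x := by rw [hK]; simp [k]
    have hx' : T x = y - J c := hx
    simp [hk, hKk, hx']

/-- With `G = (V - μ)⁻¹`, solving `(V + JK - μ) x = y` amounts to solving `(1 + K G J) c = K G y` in
`ℂⁿ`, where `c = K x` and `x = G (y - J c)`. The identity theorem for the determinant gives the two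
cases. -/
theorem isUnit_sub_smul_id_or_not_hasSVEPAt {n : ℕ} {V : Y →L[ℂ] Y} (K : Y →L[ℂ] (Fin n → ℂ))
    (J : (Fin n → ℂ) →L[ℂ] Y) (hV : IsUnit V) :
    (∀ᶠ μ in 𝓝[≠] (0 : ℂ), IsUnit (V + J ∘L K - μ • ContinuousLinearMap.id ℂ Y)) ∨
      ¬ HasSVEPAt (V + J ∘L K) 0 ∧ ¬ HasSVEPAt (banachAdjoint (V + J ∘L K)) 0 := by
  have h0 : (0 : ℂ) ∈ resolventSet ℂ V := by
    rw [spectrum.mem_resolventSet_iff]; simpa using hV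
  obtain ⟨r, hr, hball⟩ := Metric.isOpen_iff.1 (spectrum.isOpen_resolventSet V) 0 h0
  set U := Metric.ball (0 : ℂ) r with hU
  have hUo : IsOpen U := Metric.isOpen_ball
  have hUc : IsPreconnected U := (convex_ball _ _).isPreconnected
  have h0U : (0 : ℂ) ∈ U := Metric.mem_ball_self hr
  let G : ℂ → Y →L[ℂ] Y := fun μ => -resolvent V μ
  have hG : AnalyticOnNhd ℂ G U := DifferentiableOn.analyticOnNhd (fun μ hμ =>
    (spectrum.hasDerivAt_resolvent_const_left (hball hμ)).neg.differentiableAt.differentiableWithinAt)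
    hUo
  have hGr (μ : ℂ) (hμ : μ ∈ U) (y : Y) : V (G μ y) - μ • G μ y = y := by
    have := DFunLike.congr_fun (Ring.mul_inverse_cancel _ (hball hμ)) y
    simp only [mul_apply_eq_comp, Algebra.algebraMap_eq_smul_one] at this
    simpa [G, resolvent, sub_eq_add_neg, add_comm, Algebra.algebraMap_eq_smul_one] using this
  have hGl (μ : ℂ) (hμ : μ ∈ U) (y : Y) : G μ (V y - μ • y) = y := by
    have := DFunLike.congr_fun (Ring.inverse_mul_cancel _ (hball hμ)) y
    simp only [mul_apply_eq_comp, Algebra.algebraMap_eq_smul_one] at this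
    simpa [G, resolvent, sub_eq_add_neg, add_comm, Algebra.algebraMap_eq_smul_one] using this
  let M : ℂ → (Fin n → ℂ) →L[ℂ] (Fin n → ℂ) := fun μ => 1 + K ∘L G μ ∘L J
  have hMa (μ : ℂ) (c : Fin n → ℂ) : M μ c = c + K (G μ (J c)) := rfl
  let D : ℂ → Matrix (Fin n) (Fin n) ℂ := fun μ => LinearMap.toMatrix' (M μ).toLinearMap
  have hDa (μ : ℂ) (c : Fin n → ℂ) : (D μ).mulVec c = M μ c :=
    LinearMap.toMatrix'_mulVec _ _
  have hGapp (y : Y) : AnalyticOnNhd ℂ (fun μ => G μ y) U :=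
    (ContinuousLinearMap.apply ℂ Y y).comp_analyticOnNhd hG
  have hD (i j : Fin n) : AnalyticOnNhd ℂ (fun μ => D μ i j) U := by
    have h1 : AnalyticOnNhd ℂ (fun μ => M μ (Pi.single j 1)) U :=
      analyticOnNhd_const.add (K.comp_analyticOnNhd (hGapp _))
    have h2 := analyticOnNhd_pi_iff.1 h1 i
    refine h2.congr hUo fun μ _ => ?_
    simp [D, LinearMap.toMatrix'_apply]
  have hdet : AnalyticOnNhd ℂ (fun μ => (D μ).det) U := by
    simp only [Matrix.det_apply']
    refine Finset.analyticOnNhd_fun_sum _ fun σ _ => ?_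
    exact analyticOnNhd_const.mul (Finset.analyticOnNhd_fun_prod _ fun i _ => hD _ _)
  rcases (hdet 0 h0U).eventually_eq_zero_or_eventually_ne_zero with h | h
  · right
    have hz : ∀ μ ∈ U, (D μ).det = 0 :=
      hdet.eqOn_zero_of_preconnected_of_eventuallyEq_zero hUc h0U h
    constructor
    · intro hsvep
      obtain ⟨v, hv, ⟨μ, hμ, hvμ⟩, hker⟩ :=
        exists_analyticOnNhd_mulVec_eq_zero hUc ⟨0, h0U⟩ D hD hz
      have hKG (ν : ℂ) (hν : ν ∈ U) : K (G ν (J (v ν))) = -v ν := by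
        have := hker ν hν
        rw [hDa, hMa] at this
        exact eq_neg_of_add_eq_zero_right this
      refine hvμ ?_
      -- This solution is not zero: `K` sends it to `-v`.
      have := hsvep U hUo hUc h0U (fun ν => G ν (J (v ν)))
        ((hG.differentiableOn.clm_apply
          (J.comp_analyticOnNhd hv).differentiableOn).analyticOnNhd hUo) (fun ν hν => ?_) μ hμ
      · have h2 := hKG μ hμ
        rw [this, map_zero] at h2
        simpa using h2.symm
      · have h2 := hGr ν hν (J (v ν))
        simp [hKG ν hν]
        rw [← sub_eq_zero.2 h2]
        abel
    · intro hsvep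
      obtain ⟨w, hw, ⟨μ, hμ, hwμ⟩, hker⟩ :=
        exists_analyticOnNhd_mulVec_eq_zero hUc ⟨0, h0U⟩ (fun z => (D z).transpose)
          (fun i j => hD j i) (fun z hz' => by rw [Matrix.det_transpose, hz z hz'])
      have hwM (ν : ℂ) (hν : ν ∈ U) (c : Fin n → ℂ) : w ν ⬝ᵥ c + w ν ⬝ᵥ K (G ν (J c)) = 0 := by
        rw [← dotProduct_add, ← hMa, ← hDa, Matrix.dotProduct_mulVec, ← Matrix.mulVec_transpose,
          hker ν hν, zero_dotProduct]
      -- The row vector `w K G`; `φ ∘ J = -w`, so `φ = 0` would force `w = 0`.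
      let φ : ℂ → StrongDual ℂ Y := fun ν =>
        ∑ i, w ν i • ((ContinuousLinearMap.proj i : (Fin n → ℂ) →L[ℂ] ℂ) ∘L K) ∘L G ν
      have hφ (ν : ℂ) (y : Y) : φ ν y = w ν ⬝ᵥ K (G ν y) := by
        simp [φ, dotProduct]
      have hφd : DifferentiableOn ℂ φ U := DifferentiableOn.fun_sum fun i _ =>
        (analyticOnNhd_pi_iff.1 hw i).differentiableOn.smul
          ((differentiableOn_const _).clm_comp hG.differentiableOn)
      refine hwμ ?_
      have := hsvep U hUo hUc h0U φ (hφd.analyticOnNhd hUo) (fun ν hν => ?_) μ hμ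
      · refine dotProduct_eq_zero _ fun c => ?_
        have h2 := hwM μ hμ c
        rwa [← hφ, this, _root_.zero_apply, add_zero] at h2
      · ext y
        have h2 : φ ν (V y - ν • y + J (K y)) = 0 := by
          rw [hφ, map_add, map_add, hGl ν hν, dotProduct_add, hwM ν hν]
        rw [map_add, map_sub, map_smul] at h2
        simp [banachAdjoint_apply]
        rw [← h2, smul_eq_mul]
        ring
  · left
    filter_upwards [h, nhdsWithin_le_nhds (hUo.mem_nhds h0U)] with μ hdμ hμ
    have hDu : IsUnit (D μ) := (Matrix.isUnit_iff_isUnit_det _).2 (isUnit_iff_ne_zero.2 hdμ)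
    have hinj : ∀ c, M μ c = 0 → c = 0 := fun c hc => by
      rw [← hDa] at hc
      exact Matrix.mulVec_injective_of_isUnit hDu (by simpa using hc)
    have hsurj : ∀ b, ∃ c, M μ c = b := fun b => by
      obtain ⟨c, hc⟩ := Matrix.mulVec_surjective_iff_isUnit.2 hDu b
      exact ⟨c, by rw [← hDa, hc]⟩
    refine ContinuousLinearMap.isUnit_iff_bijective.2 ⟨?_, fun y => ?_⟩
    · rw [injective_iff_map_eq_zero]
      intro x hx
      have hx' : V x - μ • x = -J (K x) := by
        rw [eq_neg_iff_add_eq_zero, ← hx]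
        simp
        abel
      have h1 := hGl μ hμ x
      rw [hx', map_neg] at h1
      have hKx : K x = 0 := by
        refine hinj _ ?_
        rw [hMa]
        nth_rewrite 1 [← h1]
        simp
      simpa [hKx] using h1.symm
    · obtain ⟨c, hc⟩ := hsurj (K (G μ y))
      refine ⟨G μ (y - J c), ?_⟩
      have hK : K (G μ (y - J c)) = c := by
        rw [hMa] at hc
        rw [map_sub, map_sub, ← hc, add_sub_cancel_right]
      have h1 := hGr μ hμ (y - J c)
      simp only [_root_.sub_apply, _root_.add_apply, _root_.smul_apply,
        ContinuousLinearMap.comp_apply, ContinuousLinearMap.id_apply, hK]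
      rw [add_sub_right_comm, h1, sub_add_cancel]

end Fredholm

/-! ### From pseudo B-Weyl and SVEP to isolated spectrum -/

section PseudoBWeyl

theorem IsQuasiNilpotentOperator.isUnit_sub_smul_id {X : Type*} [NormedAddCommGroup X]
    [NormedSpace ℂ X] {T : X →L[ℂ] X}
    (hT : IsQuasiNilpotentOperator T) {μ : ℂ} (hμ : μ ≠ 0) :
    IsUnit (T - μ • ContinuousLinearMap.id ℂ X) := by
  have h : μ ∈ resolventSet ℂ T := by
    refine spectrum.mem_resolventSet_of_spectralRadius_lt ?_
    rw [IsQuasiNilpotentOperator] at hT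
    rw [hT]
    simpa using hμ
  rw [spectrum.mem_resolventSet_iff, IsUnit.sub_iff] at h
  exact h

variable {X : Type*} [NormedAddCommGroup X] [NormedSpace ℂ X] [CompleteSpace X]

theorem IsWeylOperator.eventually_isUnit_or_not_hasSVEPAt {T : X →L[ℂ] X}
    (hT : IsWeylOperator T) :
    (∀ᶠ μ in 𝓝[≠] (0 : ℂ), IsUnit (T - μ • ContinuousLinearMap.id ℂ X)) ∨
      ¬ HasSVEPAt T 0 ∧ ¬ HasSVEPAt (banachAdjoint T) 0 := by
  obtain ⟨n, V, K, J, hV, rfl⟩ := hT.exists_isUnit_add_comp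
  exact isUnit_sub_smul_id_or_not_hasSVEPAt K J hV

theorem isUnit_sub_smul_id_of_restrict {T : X →L[ℂ] X} {X₁ X₂ : Submodule ℂ X}
    (h₁ : Set.MapsTo T X₁ X₁) (h₂ : Set.MapsTo T X₂ X₂) (hc : IsCompl X₁ X₂) {μ : ℂ}
    (hu₁ : IsUnit (T.restrict h₁ - μ • ContinuousLinearMap.id ℂ X₁))
    (hu₂ : IsUnit (T.restrict h₂ - μ • ContinuousLinearMap.id ℂ X₂))
    (hcl₁ : IsClosed (X₁ : Set X)) (hcl₂ : IsClosed (X₂ : Set X)) :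
    IsUnit (T - μ • ContinuousLinearMap.id ℂ X) := by
  have := hcl₁.completeSpace_coe
  have := hcl₂.completeSpace_coe
  obtain ⟨i₁, s₁⟩ := ContinuousLinearMap.isUnit_iff_bijective.1 hu₁
  obtain ⟨i₂, s₂⟩ := ContinuousLinearMap.isUnit_iff_bijective.1 hu₂
  refine ContinuousLinearMap.isUnit_iff_bijective.2 ⟨?_, fun y => ?_⟩
  · rw [injective_iff_map_eq_zero] at i₁ i₂ ⊢
    intro x hx
    obtain ⟨a, b, ha, hb, rfl⟩ := Submodule.codisjoint_iff_exists_add_eq.1 hc.codisjoint x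
    have hmem₁ : T a - μ • a ∈ X₁ := X₁.sub_mem (h₁ ha) (X₁.smul_mem μ ha)
    have hmem₂ : T b - μ • b ∈ X₂ := X₂.sub_mem (h₂ hb) (X₂.smul_mem μ hb)
    have hsum : (T a - μ • a) + (T b - μ • b) = 0 := by
      rw [← hx]
      simp
      abel
    have ha0 : T a - μ • a = 0 := Submodule.disjoint_def.1 hc.disjoint _ hmem₁ <| by
      rw [eq_neg_of_add_eq_zero_left hsum]
      exact X₂.neg_mem hmem₂
    have hb0 : T b - μ • b = 0 := by rwa [ha0, zero_add] at hsum
    have h1 := congrArg Subtype.val (i₁ ⟨a, ha⟩ (Subtype.ext ha0))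
    have h2 := congrArg Subtype.val (i₂ ⟨b, hb⟩ (Subtype.ext hb0))
    dsimp at h1 h2
    rw [h1, h2, add_zero]
  · obtain ⟨a, b, ha, hb, rfl⟩ := Submodule.codisjoint_iff_exists_add_eq.1 hc.codisjoint y
    obtain ⟨a', ha'⟩ := s₁ ⟨a, ha⟩
    obtain ⟨b', hb'⟩ := s₂ ⟨b, hb⟩
    refine ⟨a' + b', ?_⟩
    have h1 : T a' - μ • (a' : X) = a := congrArg Subtype.val ha'
    have h2 : T b' - μ • (b' : X) = b := congrArg Subtype.val hb'
    rw [← h1, ← h2]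
    simp
    abel

theorem IsPseudoBWeyl.isGeneralizedDrazinInvertible {T : X →L[ℂ] X} (hT : IsPseudoBWeyl T)
    (hs : HasSVEPAt T 0 ∨ HasSVEPAt (banachAdjoint T) 0) : IsGeneralizedDrazinInvertible T := by
  obtain ⟨X₁, X₂, h₁, h₂, hcl₁, hcl₂, hc, hW, hQ⟩ := hT
  have := hcl₁.completeSpace_coe
  have := hcl₂.completeSpace_coe
  have htc := Submodule.IsCompl.isTopCompl_of_isClosed hc hcl₁ hcl₂
  rw [isGeneralizedDrazinInvertible_iff]
  rcases hW.eventually_isUnit_or_not_hasSVEPAt with h | ⟨hn, hn'⟩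
  · filter_upwards [h, self_mem_nhdsWithin] with μ hμ hμ0
    exact isUnit_sub_smul_id_of_restrict h₁ h₂ hc hμ (hQ.isUnit_sub_smul_id hμ0) hcl₁ hcl₂
  · exfalso
    rcases hs with hs | hs
    · exact hn (hs.of_injective_intertwining X₁.subtypeL Subtype.val_injective fun y => rfl)
    · refine hn' (hs.banachAdjoint_of_surjective_intertwining (X₁.projectionOntoL X₂ htc)
        (Submodule.projectionOntoL_surjective htc) fun x => ?_)
      obtain ⟨a, b, ha, hb, rfl⟩ := Submodule.codisjoint_iff_exists_add_eq.1 hc.codisjoint x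
      have e1 := Submodule.projectionOntoL_apply_left htc ⟨a, ha⟩
      have e2 := Submodule.projectionOntoL_apply_left htc ⟨T a, h₁ ha⟩
      have e3 := Submodule.projectionOntoL_apply_right htc ⟨b, hb⟩
      have e4 := Submodule.projectionOntoL_apply_right htc ⟨T b, h₂ hb⟩
      dsimp only at e1 e2 e3 e4
      rw [map_add, map_add, map_add, e1, e2, e3, e4, add_zero, add_zero]
      rfl

end PseudoBWeyl

/-! ### Laurent coefficients of the resolvent and the Riesz idempotent -/

section Riesz

variable {A : Type*} [NormedRing A] [NormedAlgebra ℂ A] [CompleteSpace A]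

theorem ContinuousLinearMap.circleIntegral_comp_comm {E F : Type*} [NormedAddCommGroup E]
    [NormedSpace ℂ E] [CompleteSpace E] [NormedAddCommGroup F] [NormedSpace ℂ F] [CompleteSpace F]
    (L : E →L[ℂ] F) {f : ℂ → E} {c : ℂ} {R : ℝ} (hf : CircleIntegrable f c R) :
    (∮ z in C(c, R), L (f z)) = L (∮ z in C(c, R), f z) := by
  simp only [circleIntegral]
  rw [← L.intervalIntegral_comp_comm hf.out]
  simp

/-- The coefficient of `z ^ (-m - 1)` in the Laurent expansion at `0` of the resolvent of `a`,
as an integral over the circle of radius `ρ`. -/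
noncomputable def resolventCoeff (a : A) (ρ : ℝ) (m : ℤ) : A :=
  (2 * Real.pi * Complex.I : ℂ)⁻¹ • ∮ z in C(0, ρ), z ^ m • resolvent a z

theorem two_pi_I_inv_smul_circleIntegral_zpow {ρ : ℝ} (hρ : 0 < ρ) (m : ℤ) (b : A) :
    ((2 * Real.pi * Complex.I : ℂ)⁻¹ • ∮ z in C(0, ρ), z ^ m • b) = if m = -1 then b else 0 := by
  rw [circleIntegral.integral_smul_const, smul_smul]
  split_ifs with h
  · subst h
    have := circleIntegral.integral_sub_center_inv 0 hρ.ne'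
    simp only [sub_zero] at this
    simp only [zpow_neg_one]
    rw [this, inv_mul_cancel₀ Complex.two_pi_I_ne_zero, one_smul]
  · have := circleIntegral.integral_sub_zpow_of_ne h 0 0 ρ
    simp only [sub_zero] at this
    rw [this, mul_zero, zero_smul]

variable {a : A} {ρ r : ℝ}

theorem continuousOn_zpow_smul_resolvent {s : Set ℂ} (hs : s ⊆ resolventSet ℂ a)
    (h0 : ∀ z ∈ s, z ≠ 0) (m : ℤ) : ContinuousOn (fun z : ℂ => z ^ m • resolvent a z) s :=
  fun z hz => ((continuousAt_zpow₀ z m (Or.inl (h0 z hz))).smul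
    (spectrum.hasDerivAt_resolvent_const_left (hs hz)).continuousAt).continuousWithinAt

theorem circleIntegrable_zpow_smul_resolvent (hρ : 0 < ρ)
    (h : Metric.sphere (0 : ℂ) ρ ⊆ resolventSet ℂ a) (m : ℤ) :
    CircleIntegrable (fun z : ℂ => z ^ m • resolvent a z) 0 ρ :=
  (continuousOn_zpow_smul_resolvent h
    (fun z hz => ne_zero_of_mem_sphere hρ.ne' ⟨z, hz⟩) m).circleIntegrable hρ.le

theorem commute_resolvent {A : Type*} [NormedRing A] [NormedAlgebra ℂ A] {a : A} {z : ℂ} (hz : z ∈ resolventSet ℂ a) : Commute a (resolvent a z) := by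
  rw [spectrum.resolvent_eq hz]
  refine Commute.units_inv_right ?_
  change Commute a (algebraMap ℂ A z - a)
  exact (Algebra.commute_algebraMap_right z a).sub_right (Commute.refl a)

theorem commute_resolventCoeff (hρ : 0 < ρ) (h : Metric.sphere (0 : ℂ) ρ ⊆ resolventSet ℂ a)
    (m : ℤ) : Commute a (resolventCoeff a ρ m) := by
  have hi := circleIntegrable_zpow_smul_resolvent hρ h m
  have h1 := (ContinuousLinearMap.mul ℂ A a).circleIntegral_comp_comm hi
  have h2 := ((ContinuousLinearMap.mul ℂ A).flip a).circleIntegral_comp_comm hi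
  refine Commute.smul_right ?_ _
  simp only [ContinuousLinearMap.mul_apply', ContinuousLinearMap.flip_apply] at h1 h2
  rw [Commute, SemiconjBy, ← h1, ← h2]
  refine circleIntegral.integral_congr hρ.le fun z hz => ?_
  exact ((commute_resolvent (h hz)).smul_right _).eq

/-- Integrate `a R(z) = z R(z) - 1` against `z ^ m`; the constant term contributes only its residue,
at `m = -1`. -/
theorem mul_resolventCoeff (hρ : 0 < ρ) (h : Metric.sphere (0 : ℂ) ρ ⊆ resolventSet ℂ a) (m : ℤ) :
    a * resolventCoeff a ρ m = resolventCoeff a ρ (m + 1) - if m = -1 then 1 else 0 := by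
  have hi := circleIntegrable_zpow_smul_resolvent hρ h
  have h1 := (ContinuousLinearMap.mul ℂ A a).circleIntegral_comp_comm (hi m)
  simp only [ContinuousLinearMap.mul_apply'] at h1
  have h2 : CircleIntegrable (fun z : ℂ => z ^ m • (1 : A)) 0 ρ :=
    ContinuousOn.circleIntegrable hρ.le fun z hz =>
      ((continuousAt_zpow₀ z m (Or.inl (ne_zero_of_mem_sphere hρ.ne' ⟨z, hz⟩))).smul
        continuousAt_const).continuousWithinAt
  rw [← two_pi_I_inv_smul_circleIntegral_zpow hρ m (1 : A), resolventCoeff, resolventCoeff,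
    mul_smul_comm, ← smul_sub, ← circleIntegral.integral_sub (hi _) h2, ← h1]
  congr 1
  refine circleIntegral.integral_congr hρ.le fun z hz => ?_
  have hz0 : z ≠ 0 := ne_zero_of_mem_sphere hρ.ne' ⟨z, hz⟩
  have h3 : (algebraMap ℂ A z - a) * resolvent a z = 1 := Ring.mul_inverse_cancel _ (h hz)
  rw [sub_mul, sub_eq_iff_eq_add, ← sub_eq_iff_eq_add', Algebra.algebraMap_eq_smul_one,
    smul_mul_assoc, one_mul] at h3
  rw [mul_smul_comm, ← h3, smul_sub, smul_smul, zpow_add_one₀ hz0]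

theorem exists_norm_resolventCoeff_le (hρ : 0 < ρ)
    (h : Metric.sphere (0 : ℂ) ρ ⊆ resolventSet ℂ a) :
    ∃ C, ∀ m : ℤ, ‖resolventCoeff a ρ m‖ ≤ C * ρ ^ m := by
  obtain ⟨C, hC⟩ := (isCompact_sphere (0 : ℂ) ρ).exists_bound_of_continuousOn
    (continuousOn_zpow_smul_resolvent h (fun z hz => ne_zero_of_mem_sphere hρ.ne' ⟨z, hz⟩) 0)
  refine ⟨ρ * C, fun m => ?_⟩
  rw [mul_assoc]
  refine circleIntegral.norm_two_pi_i_inv_smul_integral_le_of_norm_le_const hρ.le fun z hz => ?_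
  have h1 := hC z hz
  rw [zpow_zero, one_smul] at h1
  rw [norm_smul, norm_zpow, mem_sphere_zero_iff_norm.1 hz, mul_comm]
  gcongr

theorem resolventCoeff_eq (hρ : 0 < ρ) (hρr : ρ ≤ r)
    (h : Metric.closedBall (0 : ℂ) r \ {0} ⊆ resolventSet ℂ a) (m : ℤ) :
    resolventCoeff a r m = resolventCoeff a ρ m := by
  rw [resolventCoeff, resolventCoeff]
  congr 1
  refine Complex.circleIntegral_eq_of_differentiable_on_annulus_off_countable hρ hρr
    Set.countable_empty (continuousOn_zpow_smul_resolvent (fun z hz => h ⟨hz.1, ?_⟩) ?_ m)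
    fun z hz => ?_
  · rintro rfl
    exact hz.2 (Metric.mem_ball_self hρ)
  · rintro z hz rfl
    exact hz.2 (Metric.mem_ball_self hρ)
  · have hz0 : z ≠ 0 := by
      rintro rfl
      exact hz.1.2 (Metric.mem_closedBall_self hρ.le)
    exact (differentiableAt_zpow.2 (Or.inl hz0)).smul
      (spectrum.hasDerivAt_resolvent_const_left
        (h ⟨Metric.ball_subset_closedBall hz.1.1, hz0⟩)).differentiableAt

/-- The Riesz idempotent of a Banach algebra element at an isolated point of the spectrum. -/
theorem exists_riesz_idempotent (hr : 0 < r)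
    (h : Metric.closedBall (0 : ℂ) r \ {0} ⊆ resolventSet ℂ a) :
    ∃ p s : A, IsIdempotentElem p ∧ Commute a p ∧ Commute a s ∧ p * s = 0 ∧ a * s = 1 - p ∧
      ∀ ε > 0, ∃ C, ∀ k : ℕ, ‖a ^ k * p‖ ≤ C * ε ^ k := by
  have hs {ρ : ℝ} (hρ : 0 < ρ) (hρr : ρ ≤ r) : Metric.sphere (0 : ℂ) ρ ⊆ resolventSet ℂ a :=
    fun z hz => h ⟨Metric.closedBall_subset_closedBall hρr (Metric.sphere_subset_closedBall hz),
      ne_zero_of_mem_sphere hρ.ne' ⟨z, hz⟩⟩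
  have hsr := hs hr le_rfl
  have hpow (k : ℕ) : a ^ k * resolventCoeff a r 0 = resolventCoeff a r k := by
    induction k with
    | zero => simp
    | succ k ih =>
      rw [pow_succ', mul_assoc, ih, mul_resolventCoeff hr hsr, if_neg (by omega), sub_zero]
      push_cast; rfl
  have hneg (k : ℕ) : a ^ k * resolventCoeff a r (-1 - k) = resolventCoeff a r (-1) := by
    induction k with
    | zero => simp
    | succ k ih =>
      rw [pow_succ, mul_assoc, mul_resolventCoeff hr hsr, if_neg (by push_cast; omega), sub_zero,
        ← ih]
      congr 2
      push_cast; ring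
  have hbound (ε : ℝ) (hε : 0 < ε) (hεr : ε ≤ r) :
      ∃ C, ∀ k : ℕ, ‖resolventCoeff a r k‖ ≤ C * ε ^ k := by
    obtain ⟨C, hC⟩ := exists_norm_resolventCoeff_le hε (hs hε hεr)
    exact ⟨C, fun k => by rw [resolventCoeff_eq hε hεr h]; simpa using hC k⟩
  have hcomm := commute_resolventCoeff hr hsr
  -- Writing `c m` for the coefficients, `c 0 * c (-1) = c k * c (-1 - k)` for every `k`. Radius `r
  -- / 2` bounds the first factor and radius `r` the second, leaving a multiple of `2 ^ (-k)`.
  have hps : resolventCoeff a r 0 * resolventCoeff a r (-1) = 0 := by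
    obtain ⟨C, hC⟩ := hbound (r / 2) (by positivity) (by linarith)
    obtain ⟨C', hC'⟩ := exists_norm_resolventCoeff_le hr hsr
    have key (k : ℕ) : ‖resolventCoeff a r 0 * resolventCoeff a r (-1)‖ ≤
        C * C' * r⁻¹ * (1 / 2 : ℝ) ^ k := by
      rw [← hneg k, ← mul_assoc, ← ((hcomm 0).pow_left k).eq, hpow]
      refine (norm_mul_le _ _).trans ?_
      calc _ ≤ C * (r / 2) ^ k * (C' * r ^ (-1 - k : ℤ)) :=
            mul_le_mul (hC k) (hC' _) (norm_nonneg _) ((norm_nonneg _).trans (hC k))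
        _ = _ := by
          rw [zpow_sub₀ hr.ne', zpow_natCast, zpow_neg_one, div_pow, div_pow, one_pow]
          field_simp
    refine norm_le_zero_iff.1 (ge_of_tendsto' (x := Filter.atTop) ?_ key)
    simpa using (tendsto_pow_atTop_nhds_zero_of_lt_one (by norm_num : (0 : ℝ) ≤ 1 / 2)
      (by norm_num)).const_mul (C * C' * r⁻¹)
  have has : a * resolventCoeff a r (-1) = resolventCoeff a r 0 - 1 := by
    simpa using mul_resolventCoeff hr hsr (-1)
  refine ⟨resolventCoeff a r 0, -resolventCoeff a r (-1), ?_, hcomm 0, (hcomm _).neg_right,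
    by rw [mul_neg, hps, neg_zero], by rw [mul_neg, has, neg_sub], fun ε hε => ?_⟩
  · have : resolventCoeff a r 0 * (resolventCoeff a r 0 - 1) = 0 := by
      rw [← has, ← mul_assoc, ← (hcomm 0).eq, mul_assoc, hps, mul_zero]
    rwa [mul_sub, mul_one, sub_eq_zero] at this
  · obtain ⟨C, hC⟩ := hbound (min ε r) (lt_min hε hr) (min_le_right _ _)
    have hC0 : 0 ≤ C := by simpa using (norm_nonneg _).trans (hC 0)
    refine ⟨C, fun k => ?_⟩
    rw [hpow]
    refine (hC k).trans ?_
    have : 0 ≤ min ε r := (lt_min hε hr).le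
    gcongr
    exact min_le_left _ _

end Riesz

/-! ### From isolated spectrum to the pseudo B-Weyl decomposition -/

section GeneralizedDrazin

variable {X : Type*} [NormedAddCommGroup X] [NormedSpace ℂ X]

theorem isWeylOperator_of_isUnit {T : X →L[ℂ] X} (hT : IsUnit T) : IsWeylOperator T := by
  obtain ⟨u, rfl⟩ := hT
  have hl (x : X) : (u⁻¹).val (u.val x) = x := DFunLike.congr_fun u.inv_mul x
  have hr (x : X) : u.val ((u⁻¹).val x) = x := DFunLike.congr_fun u.mul_inv x
  have hker : u.val.ker = ⊥ := by
    rw [LinearMap.ker_eq_bot']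
    intro x hx
    have hx' : u.val x = 0 := hx
    rw [← hl x, hx', map_zero]
  have hran : u.val.range = ⊤ := LinearMap.range_eq_top.2 fun x => ⟨_, hr x⟩
  refine ⟨ContinuousLinearMap.IsFredholm.of_isQuasiInverse (v := (u⁻¹).val) ?_, ?_⟩
  · exact LinearEquiv.isQuasiInverse
      (LinearEquiv.ofLinearMap u.val.toLinearMap (u⁻¹).val.toLinearMap
        (LinearMap.ext hr) (LinearMap.ext hl))
  · rw [hker, hran, finrank_bot]
    simp [Module.finrank_zero_of_subsingleton]

variable [CompleteSpace X]

theorem isQuasiNilpotentOperator_of_norm_pow_le {T : X →L[ℂ] X}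
    (h : ∀ ε > 0, ∃ C, ∀ k : ℕ, ‖T ^ k‖ ≤ C * ε ^ k) : IsQuasiNilpotentOperator T := by
  rw [IsQuasiNilpotentOperator, spectralRadius, ← nonpos_iff_eq_zero]
  refine iSup₂_le fun z hz => ?_
  suffices z = 0 by simp [this]
  by_contra hz0
  have hz0' : 0 < ‖z‖ := norm_pos_iff.2 hz0
  obtain ⟨C, hC⟩ := h (‖z‖ / 2) (by positivity)
  -- `X` may be zero, so `‖1‖` is kept rather than replaced by 1.
  have key (k : ℕ) : (1 : ℝ) ≤ C * ‖(1 : X →L[ℂ] X)‖ * (1 / 2 : ℝ) ^ k := by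
    have h1 := spectrum.norm_le_norm_mul_of_mem (spectrum.pow_mem_pow T k hz)
    rw [norm_pow] at h1
    have h2 := h1.trans (mul_le_mul_of_nonneg_right (hC k) (norm_nonneg _))
    have h3 : 0 < ‖z‖ ^ k := by positivity
    refine le_of_mul_le_mul_right ?_ h3
    rw [one_mul]
    refine h2.trans_eq ?_
    rw [div_pow, div_pow, one_pow]
    ring
  have hlim := (tendsto_pow_atTop_nhds_zero_of_lt_one (by norm_num : (0 : ℝ) ≤ 1 / 2)
      (by norm_num)).const_mul (C * ‖(1 : X →L[ℂ] X)‖)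
  rw [mul_zero] at hlim
  exact absurd (ge_of_tendsto' hlim key) (by norm_num)

/-- On the kernel of the Riesz idempotent `P`, `T S = 1 - P` makes `S` an inverse of `T`; on its
range the powers of `T` agree with `T ^ k * P`, which decays faster than any geometric sequence. -/
theorem IsGeneralizedDrazinInvertible.isPseudoBWeyl {T : X →L[ℂ] X}
    (hT : IsGeneralizedDrazinInvertible T) : IsPseudoBWeyl T := by
  have hev : ∀ᶠ μ in 𝓝[≠] (0 : ℂ), μ ∈ resolventSet ℂ T := by
    filter_upwards [(isGeneralizedDrazinInvertible_iff T).1 hT] with μ hμ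
    rw [spectrum.mem_resolventSet_iff, IsUnit.sub_iff]
    exact hμ
  obtain ⟨r, hr, hball⟩ := (nhdsWithin_hasBasis Metric.nhds_basis_closedBall _).mem_iff.1 hev
  obtain ⟨P, S, hP, hTP, hTS, hPS, hTS1, hbd⟩ := exists_riesz_idempotent hr hball
  have htc := ContinuousLinearMap.IsIdempotentElem.isTopCompl hP
  have hTPx (x : X) : T (P x) = P (T x) := DFunLike.congr_fun hTP.eq x
  have hTSx (x : X) : T (S x) = S (T x) := DFunLike.congr_fun hTS.eq x
  have hPSx (x : X) : P (S x) = 0 := DFunLike.congr_fun hPS x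
  have hTS1x (x : X) : T (S x) = x - P x := DFunLike.congr_fun hTS1 x
  have h₁ : Set.MapsTo T P.ker P.ker := fun x hx => by
    have hx' : P x = 0 := hx
    change P (T x) = 0
    rw [← hTPx, hx', map_zero]
  have h₂ : Set.MapsTo T P.range P.range := by
    rintro _ ⟨x, rfl⟩
    exact ⟨T x, (hTPx x).symm⟩
  have hcl₂ : IsClosed (P.range : Set X) := htc.isClosed
  have hcs₁ : CompleteSpace P.ker := P.isClosed_ker.completeSpace_coe
  have hcs₂ : CompleteSpace P.range := hcl₂.completeSpace_coe
  refine ⟨P.ker, P.range, h₁, h₂, P.isClosed_ker, hcl₂, htc.isCompl.symm,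
    isWeylOperator_of_isUnit ?_, isQuasiNilpotentOperator_of_norm_pow_le fun ε hε => ?_⟩
  · have hTSk (x : P.ker) : T (S x) = x := by
      have hx : P (x : X) = 0 := x.2
      rw [hTS1x, hx, sub_zero]
    refine ContinuousLinearMap.isUnit_iff_bijective.2 ⟨?_, fun y => ?_⟩
    · rw [injective_iff_map_eq_zero]
      intro x hx
      have hx' : T x = 0 := congrArg Subtype.val hx
      ext
      rw [← hTSk x, hTSx, hx', map_zero]
      rfl
    · exact ⟨⟨S y, hPSx y⟩, Subtype.ext (hTSk y)⟩
  · obtain ⟨C, hC⟩ := hbd ε hε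
    have hC0 : 0 ≤ C := by simpa using (norm_nonneg _).trans (hC 0)
    refine ⟨C, fun k => ContinuousLinearMap.opNorm_le_bound _ (by positivity) fun x => ?_⟩
    have hpow : (((T.restrict h₂) ^ k) x : X) = (T ^ k) x := by
      induction k generalizing x with
      | zero => rfl
      | succ k ih => rw [pow_succ, pow_succ]; exact ih _
    have hPx : P (x : X) = x := by
      obtain ⟨y, hy⟩ := x.2
      rw [← hy]
      exact DFunLike.congr_fun hP.eq y
    have hx : (T ^ k) (x : X) = (T ^ k * P) x := by
      rw [mul_apply_eq_comp, hPx]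
    rw [Submodule.coe_norm, hpow, hx, Submodule.coe_norm]
    exact (T ^ k * P).le_of_opNorm_le (hC k) _

end GeneralizedDrazin

theorem mainTheorem1 {X : Type*} [NormedAddCommGroup X] [NormedSpace ℂ X] [CompleteSpace X]
    (T : X →L[ℂ] X) :
    pseudoBWeylSpectrum T ∪ (svepFailureSet T ∩ svepFailureSet (banachAdjoint T)) =
      generalizedDrazinSpectrum T := by
  ext z
  simp only [pseudoBWeylSpectrum, svepFailureSet, generalizedDrazinSpectrum, Set.mem_union,
    Set.mem_inter_iff, Set.mem_ofPred_eq]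
  rw [← hasSVEPAt_sub_smul_id_iff (T := T), ← hasSVEPAt_sub_smul_id_iff (T := banachAdjoint T),
    ← banachAdjoint_sub_smul_id]
  have h₁ := fun h => IsGeneralizedDrazinInvertible.isPseudoBWeyl
    (T := T - z • ContinuousLinearMap.id ℂ X) h
  have h₂ := fun h => IsGeneralizedDrazinInvertible.hasSVEPAt
    (T := T - z • ContinuousLinearMap.id ℂ X) h
  have h₃ := fun h => IsPseudoBWeyl.isGeneralizedDrazinInvertible
    (T := T - z • ContinuousLinearMap.id ℂ X) h
  tauto
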